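/- \textbf{Definitions.} A \emph{masked unique hard-attention transformer} (UHAT) over a finite alphabet $\Sigma$ consists of a token embedding $\Sigma\to\mathbb{Q}^d$ ($d>0$), a finite sequence of layers of matching widths, an acceptance vector $t\in\mathbb{Q}^s$, and an output position (first or last). A layer is one of the following. \begin{itemize} \item A \emph{ReLU layer} replaces one fixed coordinate $x$ of every vector by $\max\{0,x\}$. \item An \emph{attention layer} of width $r>0$ is given by affine maps $A,B\colon\mathbb{Q}^r\to\mathbb{Q}^r$ and $C\colon\mathbb{Q}^{2r}\to\mathbb{Q}^{s'}$ with rational coefficients, a mask (none, $j<i$, or $j>i$) and a tie-breaking rule (leftmost or rightmost). It maps $v_1,\dots,v_n$ to $C(v_1,a_1),\dots,C(v_n,a_n)$, where $a_i=v_j$ for the leftmost (respectively rightmost) unmasked position $j$ that maximizes $\langle A(v_i),B(v_j)\rangle$, and $a_i=0$ if no position is unmasked for $i$. \end{itemize} A nonempty word is accepted if the output vector $v$ at the output position satisfies $\langle t,v\rangle>0$; the empty word is not accepted. A finite automaton is a nondeterministic finite automaton without $\varepsilon$-transitions. The size $|R|$ of a UHAT or of a finite automaton $R$ is the length of its usual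 binary encoding: for a UHAT, all rational entries of the embedding, of the layers and of the acceptance vector are written in binary; for an automaton, all states, with their status as initial or accepting, and all transitions are listed. We write $f\in 2^{2^{o(n)}}$ if $f(n)\le 2^{2^{g(n)}}$ for all $n$, for some $g$ with $g(n)=o(n)$. \textbf{Theorem.} \begin{enumerate} \item UHATs can be doubly exponentially more succinct than finite automata: for every function $f\in 2^{2^{o(n)}}$ there is a UHAT $\mathcal{T}$ such that every finite automaton $\mathcal{A}$ with $L(\mathcal{A})=L(\mathcal{T})$ has size $|\mathcal{A}|>f(|\mathcal{T}|)$. \item There are UHATs $\mathcal{T}_n$ ($n\ge 0$) of size at most $p(n)$, for some polynomial $p$, such that $L(\mathcal{T}_n)\neq\emptyset$ and every word in $L(\mathcal{T}_n)$ has length at least $2^{2^n}$, and such that for every $f\in 2^{2^{o(n)}}$ the UHAT $\mathcal{T}$ in (1) can be chosen among the $\mathcal{T}_n$. \item Every finite automaton that recognizes a non-empty language accepts a word whose length is at most its number of states. \end{enumerate} -/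

import Mathlib

open Filter Asymptotics

/-! ### Classes of representations and succinctness -/

/-- A class of finite representations of languages.  An alphabet with `k` symbols is `Fin k`. -/
structure RepresentationClass where
  /-- the representations of languages over the alphabet `Fin k` -/
  Rep : ℕ → Type
  /-- the represented language -/
  lang : ∀ {k : ℕ}, Rep k → Language (Fin k)
  /-- the length of the binary encoding -/
  size : ∀ {k : ℕ}, Rep k → ℕ

/-- `f ∈ 2^{2^{o(n)}}`. -/
def IsDoublyExpLittleO (f : ℕ → ℝ) : Prop :=
  ∃ g : ℕ → ℝ, g =o[atTop] (fun n : ℕ => (n : ℝ)) ∧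
    ∀ n, f n ≤ (2 : ℝ) ^ ((2 : ℝ) ^ g n)

/-- Every representation in `C₂` of the language of `R` has size larger than `f |R|`. -/
def ForcesBlowup {C₁ : RepresentationClass} (C₂ : RepresentationClass) (f : ℕ → ℝ) {k : ℕ}
    (R : C₁.Rep k) : Prop :=
  ∀ R₂ : C₂.Rep k, C₂.lang R₂ = C₁.lang R → f (C₁.size R) < (C₂.size R₂ : ℝ)

/-- `C₁` can be doubly exponentially more succinct than `C₂`. -/
def CanBeDoublyExpMoreSuccinct (C₁ C₂ : RepresentationClass) : Prop :=
  ∀ f : ℕ → ℝ, IsDoublyExpLittleO f →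
    ∃ (k : ℕ) (R : C₁.Rep k), ForcesBlowup C₂ f R

/-! ### Self-delimiting binary codes -/

/-- Each binary digit is preceded by the bit `true`; the bit `false` ends the code. -/
def natCode (n : ℕ) : List Bool :=
  (Nat.bits n).flatMap (fun b => [true, b]) ++ [false]

/-- Sign, numerator and denominator (in lowest terms). -/
def ratCode (q : ℚ) : List Bool :=
  decide (q < 0) :: (natCode q.num.natAbs ++ natCode q.den)

def vecCode {n : ℕ} (v : Fin n → ℚ) : List Bool :=
  (List.finRange n).flatMap fun i => ratCode (v i)

/-! ### Masked unique hard-attention transformers -/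

/-- An affine transformation `x ↦ Q x + b` from `ℚ^m` to `ℚ^n`. -/
structure RatAffine (m n : ℕ) where
  mat : Matrix (Fin n) (Fin m) ℚ
  vec : Fin n → ℚ

def RatAffine.apply {m n : ℕ} (T : RatAffine m n) (x : Fin m → ℚ) : Fin n → ℚ :=
  T.mat.mulVec x + T.vec

def RatAffine.code {m n : ℕ} (T : RatAffine m n) : List Bool :=
  ((List.finRange n).flatMap fun i => vecCode (T.mat i)) ++ vecCode T.vec

/-- No masking, strict future masking (`j < i`), strict past masking (`j > i`). -/
inductive Mask
  | none
  | strictFuture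
  | strictPast

def Mask.allows {n : ℕ} : Mask → Fin n → Fin n → Prop
  | .none, _, _ => True
  | .strictFuture, i, j => j < i
  | .strictPast, i, j => i < j

def Mask.code : Mask → List Bool
  | .none => [false, false]
  | .strictFuture => [true, false]
  | .strictPast => [false, true]

inductive TieBreak
  | leftmost
  | rightmost

def TieBreak.select {n : ℕ} : TieBreak → (B : Finset (Fin n)) → B.Nonempty → Fin n
  | .leftmost, B, h => B.min' h
  | .rightmost, B, h => B.max' h

def TieBreak.code : TieBreak → List Bool
  | .leftmost => [false]
  | .rightmost => [true]

/-- A unique hard-attention layer of width `r > 0` with outputs in `ℚ^s`. -/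
structure AttentionLayer (r s : ℕ) where
  width_pos : 0 < r
  A : RatAffine r r
  B : RatAffine r r
  C : RatAffine (r + r) s
  mask : Mask
  tie : TieBreak

namespace AttentionLayer

variable {r s n : ℕ} (ℓ : AttentionLayer r s) (v : Fin n → Fin r → ℚ)

/-- The score of position `j` as seen from position `i`. -/
def score (i j : Fin n) : ℚ :=
  dotProduct (ℓ.A.apply (v i)) (ℓ.B.apply (v j))

open Classical in
/-- The set `U_i` of unmasked positions. -/
noncomputable def unmasked (i : Fin n) : Finset (Fin n) :=
  Finset.univ.filter fun j => ℓ.mask.allows i j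

open Classical in
/-- The set `B_i` of unmasked positions of maximal score. -/
noncomputable def best (i : Fin n) : Finset (Fin n) :=
  (ℓ.unmasked i).filter fun j => ∀ j' ∈ ℓ.unmasked i, ℓ.score v i j' ≤ ℓ.score v i j

theorem best_nonempty (i : Fin n) (h : (ℓ.unmasked i).Nonempty) : (ℓ.best v i).Nonempty := by
  obtain ⟨j, hj, hmax⟩ := Finset.exists_max_image (ℓ.unmasked i) (ℓ.score v i) h
  exact ⟨j, Finset.mem_filter.2 ⟨hj, hmax⟩⟩

open Classical in
/-- The attention vector at position `i`. -/
noncomputable def attentionVector (i : Fin n) : Fin r → ℚ :=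
  if h : (ℓ.unmasked i).Nonempty then v (ℓ.tie.select (ℓ.best v i) (ℓ.best_nonempty v i h))
  else 0

/-- The output sequence `C(v_1, a_1), …, C(v_n, a_n)`. -/
noncomputable def eval (i : Fin n) : Fin s → ℚ :=
  ℓ.C.apply (Fin.append (v i) (ℓ.attentionVector v i))

def code : List Bool :=
  natCode s ++ ℓ.mask.code ++ ℓ.tie.code ++ ℓ.A.code ++ ℓ.B.code ++ ℓ.C.code

end AttentionLayer

/-- The ReLU layer acting on coordinate `k`. -/
def reluLayer {r n : ℕ} (k : Fin r) (v : Fin n → Fin r → ℚ) (i : Fin n) : Fin r → ℚ :=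
  Function.update (v i) k (max 0 (v i k))

/-- Sequences of attention layers and ReLU layers of matching widths, with inputs in `ℚ^r` and
outputs in `ℚ^t`.  The first layer of `attention ℓ L` and of `relu k L` is applied first. -/
inductive LayerSeq : ℕ → ℕ → Type
  | nil (r : ℕ) : LayerSeq r r
  | attention {r s t : ℕ} (ℓ : AttentionLayer r s) (L : LayerSeq s t) : LayerSeq r t
  | relu {r t : ℕ} (k : Fin r) (L : LayerSeq r t) : LayerSeq r t

noncomputable def LayerSeq.eval {n : ℕ} :
    {r t : ℕ} → LayerSeq r t → (Fin n → Fin r → ℚ) → (Fin n → Fin t → ℚ)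
  | _, _, .nil _, v => v
  | _, _, .attention ℓ L, v => L.eval (ℓ.eval v)
  | _, _, .relu k L, v => L.eval (reluLayer k v)

def LayerSeq.code : {r t : ℕ} → LayerSeq r t → List Bool
  | _, _, .nil _ => [false, false]
  | _, _, .attention ℓ L => [true, false] ++ ℓ.code ++ L.code
  | _, _, .relu k L => [false, true] ++ natCode k ++ L.code

inductive OutputPosition
  | first
  | last

def OutputPosition.index : OutputPosition → (n : ℕ) → 0 < n → Fin n
  | .first, _, h => ⟨0, h⟩
  | .last, n, h => ⟨n - 1, Nat.sub_lt h Nat.one_pos⟩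

def OutputPosition.code : OutputPosition → List Bool
  | .first => [false]
  | .last => [true]

/-- A masked unique hard-attention transformer over the alphabet `Fin k`, given together with an
acceptance vector and an output position. -/
structure UHAT (k : ℕ) where
  /-- dimension of the token embedding -/
  d : ℕ
  d_pos : 0 < d
  emb : Fin k → Fin d → ℚ
  /-- dimension of the output vectors -/
  s : ℕ
  layers : LayerSeq d s
  acceptVec : Fin s → ℚ
  output : OutputPosition

namespace UHAT

variable {k : ℕ} (T : UHAT k)

/-- The output sequence of the transformer on a word. -/
noncomputable def run (w : List (Fin k)) : Fin w.length → Fin T.s → ℚ :=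
  T.layers.eval fun i => T.emb (w.get i)

/-- The recognized language (the empty word has no output position and is not accepted). -/
def lang : Language (Fin k) :=
  {w | ∃ h : 0 < w.length,
    0 < dotProduct T.acceptVec (T.run w (T.output.index w.length h))}

/-- The binary encoding: alphabet size, embedding, layers, acceptance vector, output position. -/
def code : List Bool :=
  natCode k ++ natCode T.d ++ ((List.finRange k).flatMap fun a => vecCode (T.emb a)) ++
    T.layers.code ++ vecCode T.acceptVec ++ T.output.code

def size : ℕ := T.code.length

end UHAT

/-- The class of masked unique hard-attention transformers. -/
def uhatClass : RepresentationClass where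
  Rep := UHAT
  lang := UHAT.lang
  size := UHAT.size

/-! ### Finite automata -/

/-- A (nondeterministic) finite automaton over the alphabet `Fin k`; its states are the elements
of `Fin numStates`. -/
structure FiniteAutomaton (k : ℕ) where
  numStates : ℕ
  nfa : NFA (Fin k) (Fin numStates)

namespace FiniteAutomaton

variable {k : ℕ} (A : FiniteAutomaton k)

def lang : Language (Fin k) := A.nfa.accepts

open Classical in
/-- The binary encoding: alphabet size, number of states, for each state two bits that tell
whether it is initial and whether it is accepting, and the list of all transitions `(q, a, q')`. -/
noncomputable def code : List Bool :=
  natCode k ++ natCode A.numStates ++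
    ((List.finRange A.numStates).flatMap fun q =>
      [decide (q ∈ A.nfa.start), decide (q ∈ A.nfa.accept)]) ++
    ((List.finRange A.numStates).flatMap fun q =>
      (List.finRange k).flatMap fun a =>
        (List.finRange A.numStates).flatMap fun q' =>
          if q' ∈ A.nfa.step q a then [true] ++ natCode q ++ natCode a ++ natCode q' else []) ++
    [false]

noncomputable def size : ℕ := A.code.length

end FiniteAutomaton

/-- The class of finite automata. -/
noncomputable def finiteAutomatonClass : RepresentationClass where
  Rep := FiniteAutomaton
  lang := FiniteAutomaton.lang
  size := FiniteAutomaton.size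

/-! A nonempty language of an automaton contains a word no longer than the number of states
(pigeonhole on a shortest word), so it suffices to have transformers of size linear in `t` whose
shortest words are doubly exponential in `t`. Linear size, not merely polynomial, is what beats
every f in 2^{2^{o(n)}}.

Such words consist of binary digits and two kinds of markers, `2` and `3`; the `t` tokens before a
marker spell its level. `IsLayered` demands that each marker of level c + 1 be charged to a `3` of
level c and each `3` to a `2` of the same level. Both charges are injective, so the number of
markers at least doubles with each step down. Since the last token is a marker of level 2 ^ t - 1,
the length is at least 2 ^ (2 ^ t - 1) (`IsLayered.two_pow_le`). The conditions are satisfiable: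
number blocks by m ≥ 1, take the 3-adic valuation of m as level and the last nonzero ternary digit
of m as marker (`isLayered_rulerWord`).

A transformer checks the conditions by hard attention (`HasLevels.eval_testLayers_pos_iff`). A
bilinear score such as 2cx - x² is maximal at x = c, so attention finds the rightmost earlier marker
of a required level. This needs the square of the level, which is not affine; it is computed along
with the level by `t` copies of one fixed layer (`IsState.step`), and this keeps the size linear in
`t`. -/

/-! ### Short words accepted by automata -/

namespace NFA

variable {α σ : Type*} (M : NFA α σ)

theorem mem_accepts_append_iff (x y : List α) :
    x ++ y ∈ M.accepts ↔
      ∃ q ∈ M.evalFrom M.start x, ∃ f ∈ M.accept, f ∈ M.evalFrom {q} y := by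
  rw [NFA.mem_accepts, NFA.evalFrom_append]
  constructor
  · rintro ⟨f, hf, h⟩
    rw [NFA.mem_evalFrom_iff_exists] at h
    obtain ⟨q, hq, h⟩ := h
    exact ⟨q, hq, f, hf, h⟩
  · rintro ⟨q, hq, f, hf, h⟩
    refine ⟨f, hf, ?_⟩
    rw [NFA.mem_evalFrom_iff_exists]
    exact ⟨q, hq, h⟩

/-- A nonempty regular language contains a word that is not longer than the number of states. -/
theorem exists_mem_accepts_length_le [Fintype σ] (h : ∃ w, w ∈ M.accepts) :
    ∃ w ∈ M.accepts, w.length ≤ Fintype.card σ := by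
  obtain ⟨w, hw, hmin⟩ := (measure (List.length (α := α))).wf.has_min {w | w ∈ M.accepts} h
  refine ⟨w, hw, ?_⟩
  by_contra! hlt
  -- One state for each cut of a shortest accepted word. Equal states at two cuts allow the stretch
  -- between them to be removed.
  have key : ∀ k : Fin w.length, ∃ q ∈ M.evalFrom M.start (w.take k),
      ∃ f ∈ M.accept, f ∈ M.evalFrom {q} (w.drop k) := fun k => by
    rw [← mem_accepts_append_iff, List.take_append_drop]
    exact hw
  choose q hq hacc using key
  obtain ⟨i, j, hij, hqe⟩ := Fintype.exists_ne_map_eq_of_card_lt q (by simpa using hlt)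
  wlog hlt' : i < j generalizing i j
  · exact this j i hij.symm hqe.symm (lt_of_le_of_ne (not_lt.1 hlt') hij.symm)
  refine hmin (w.take i ++ w.drop j) ?_ ?_
  · exact (M.mem_accepts_append_iff _ _).2 ⟨q i, hq i, hqe ▸ hacc j⟩
  · change (w.take i ++ w.drop j).length < w.length
    have := j.2
    have : (i : ℕ) < j := hlt'
    simp only [List.length_append, List.length_take, List.length_drop]
    omega

end NFA

theorem FiniteAutomaton.exists_mem_lang_length_le {k : ℕ} (A : FiniteAutomaton k)
    (h : ∃ w, w ∈ A.lang) : ∃ w ∈ A.lang, w.length ≤ A.numStates := by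
  simpa [lang] using A.nfa.exists_mem_accepts_length_le h

open Classical in
theorem FiniteAutomaton.numStates_lt_size {k : ℕ} (A : FiniteAutomaton k) :
    A.numStates < A.size := by
  have h : ((List.finRange A.numStates).flatMap fun q =>
      [decide (q ∈ A.nfa.start), decide (q ∈ A.nfa.accept)]).length = A.numStates * 2 := by
    simp [List.length_flatMap]
  unfold size code
  simp only [List.length_append, List.length_singleton]
  have h' := h.ge
  convert_to A.numStates < _ + _ + ((List.finRange A.numStates).flatMap fun q =>
      [decide (q ∈ A.nfa.start), decide (q ∈ A.nfa.accept)]).length + _ + 1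
  omega

/-- Representations of size linear in `n` whose shortest words have length at least `2 ^ 2 ^ n`
force every doubly exponential blow-up below the linear rate. -/
theorem exists_forcesBlowup_of_linear_size {k : ℕ → ℕ} (T : (n : ℕ) → UHAT (k n)) {a b : ℕ}
    (hb : 0 < b) (hsize : ∀ n, (T n).size = a + b * n) (hne : ∀ n, ∃ w, w ∈ (T n).lang)
    (hlen : ∀ n, ∀ w ∈ (T n).lang, 2 ^ 2 ^ n ≤ w.length) {f : ℕ → ℝ}
    (hf : IsDoublyExpLittleO f) :
    ∃ n, ForcesBlowup (C₁ := uhatClass) finiteAutomatonClass f (T n) := by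
  obtain ⟨g, hg, hfg⟩ := hf
  -- With this constant, g (a + b n) ≤ (a + b n) / (2b) ≤ n as soon as a ≤ n. Taking n = m₀ + a
  -- ensures this and also that the size exceeds the threshold m₀.
  have hc : (0 : ℝ) < 1 / (2 * b) := by positivity
  obtain ⟨m₀, hm₀⟩ := eventually_atTop.1 (hg.bound hc)
  obtain ⟨n, hn⟩ : ∃ n, n = m₀ + a := ⟨_, rfl⟩
  refine ⟨n, fun A hA => ?_⟩
  have hn_le : n ≤ (T n).size := by
    rw [hsize]
    nlinarith
  have hgle : g (T n).size ≤ n := by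
    refine (le_abs_self _).trans ((hm₀ _ (by omega)).trans ?_)
    rw [hsize, Real.norm_natCast, one_div, inv_mul_le_iff₀ (by positivity)]
    have h1 : (a : ℝ) ≤ n := by rw [hn]; push_cast; linarith [Nat.cast_nonneg (α := ℝ) m₀]
    have h2 : (1 : ℝ) ≤ b := by exact_mod_cast hb
    push_cast
    nlinarith [Nat.cast_nonneg (α := ℝ) n]
  obtain ⟨w, hw⟩ := hne n
  have hA' : FiniteAutomaton.lang A = (T n).lang := hA
  obtain ⟨w', hw', hle⟩ := FiniteAutomaton.exists_mem_lang_length_le A ⟨w, by rwa [hA']⟩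
  have hw'' : w' ∈ (T n).lang := hA' ▸ hw'
  have hlow : 2 ^ 2 ^ n < A.size := ((hlen n w' hw'').trans hle).trans_lt A.numStates_lt_size
  calc f (T n).size ≤ (2 : ℝ) ^ ((2 : ℝ) ^ g (T n).size) := hfg _
    _ ≤ (2 : ℝ) ^ ((2 : ℝ) ^ (n : ℝ)) := by
        gcongr <;> norm_num
    _ = ((2 ^ 2 ^ n : ℕ) : ℝ) := by
        push_cast
        rw [Real.rpow_natCast, ← Real.rpow_natCast 2 (2 ^ n)]
        push_cast
        rfl
    _ < (A.size : ℝ) := by exact_mod_cast hlow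

/-! ### Marked words -/

section MarkedWords

/-- The tokens `0` and `1` are binary digits, the tokens `2` and `3` are markers. -/
def IsMarker (a : Fin 4) : Prop := a = 2 ∨ a = 3

/-- The binary digit of a token. -/
def tokenBit (a : Fin 4) : ℕ := if a = 1 then 1 else 0

/-- The number whose binary digits are the `t` tokens before position `i`. -/
def level (x : ℕ → Fin 4) : ℕ → ℕ → ℕ
  | 0, _ => 0
  | _ + 1, 0 => 0
  | t + 1, i + 1 => tokenBit (x i) + 2 * level x t i

theorem tokenBit_le_one (a : Fin 4) : tokenBit a ≤ 1 := by
  unfold tokenBit; split <;> omega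

theorem level_lt (x : ℕ → Fin 4) : ∀ t i, level x t i < 2 ^ t
  | 0, _ => by simp [level]
  | _ + 1, 0 => by simp [level]
  | t + 1, i + 1 => by
    have := level_lt x t i
    have := tokenBit_le_one (x i)
    simp only [level, pow_succ]
    omega

/-- The rightmost marker before `i` among those whose level is the level of `i` or the one below
is a `3` of the level below. -/
def FollowsLower (x : ℕ → Fin 4) (t i : ℕ) : Prop :=
  ∃ j < i, x j = 3 ∧ level x t j + 1 = level x t i ∧
    ∀ k, j < k → k < i → IsMarker (x k) →
      level x t k ≠ level x t i ∧ level x t k + 1 ≠ level x t i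

/-- The rightmost marker before `i` of the same level as `i` is a `2`. -/
def FollowsEqual (x : ℕ → Fin 4) (t i : ℕ) : Prop :=
  ∃ j < i, x j = 2 ∧ level x t j = level x t i ∧
    ∀ k, j < k → k < i → IsMarker (x k) → level x t k ≠ level x t i

/-- The last three fields provide one marker of the highest level; the first two force its presence
to propagate downwards, doubling the count at each level. -/
structure IsLayered (x : ℕ → Fin 4) (t L : ℕ) : Prop where
  followsLower : ∀ i < L, IsMarker (x i) → level x t i ≠ 0 → FollowsLower x t i
  followsEqual : ∀ i < L, x i = 3 → FollowsEqual x t i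
  pos : 0 < L
  isMarker_last : IsMarker (x (L - 1))
  level_last : level x t (L - 1) + 1 = 2 ^ t

variable {x : ℕ → Fin 4} {t L : ℕ}

open Classical in
/-- The positions of the markers of level `c` among the tokens of a set. -/
noncomputable def markerPositions (x : ℕ → Fin 4) (t L : ℕ) (A : Set (Fin 4)) (c : ℕ) :
    Finset ℕ :=
  (Finset.range L).filter fun i => x i ∈ A ∧ level x t i = c

theorem mem_markerPositions {A : Set (Fin 4)} {c i : ℕ} :
    i ∈ markerPositions x t L A c ↔ i < L ∧ x i ∈ A ∧ level x t i = c := by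
  simp [markerPositions]

/-- Sending a marker to the `3` that it follows is injective: if i < i' had the same image, then i
would be a marker of the level of i' between that image and i', which `FollowsLower` forbids. -/
theorem IsLayered.card_succ_le (h : IsLayered x t L) (c : ℕ) :
    (markerPositions x t L {2, 3} (c + 1)).card ≤ (markerPositions x t L {3} c).card := by
  have key : ∀ i ∈ markerPositions x t L {2, 3} (c + 1), FollowsLower x t i := fun i hi => by
    obtain ⟨h1, h2, h3⟩ := mem_markerPositions.1 hi
    exact h.followsLower i h1 h2 (by omega)
  choose! f hf using key
  refine Finset.card_le_card_of_injOn f (fun i hi => ?_) fun i hi i' hi' he => ?_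
  · obtain ⟨h1, h2, h3⟩ := mem_markerPositions.1 hi
    obtain ⟨g1, g2, g3, -⟩ := hf i hi
    exact mem_markerPositions.2 ⟨by omega, g2, by omega⟩
  · wlog hlt : i < i' generalizing i i'
    · rcases eq_or_lt_of_le (not_lt.1 hlt) with h' | h'
      · exact h'.symm
      · exact (this i' hi' i hi he.symm h').symm
    obtain ⟨h1, h2, h3⟩ := mem_markerPositions.1 hi
    obtain ⟨-, -, h3'⟩ := mem_markerPositions.1 hi'
    obtain ⟨g1, -⟩ := hf i hi
    obtain ⟨-, -, -, g4⟩ := hf i' hi'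
    exact absurd (h3.trans h3'.symm) (g4 i (by omega) hlt h2).1

/-- The same injectivity argument, now with `FollowsEqual`. -/
theorem IsLayered.card_three_le (h : IsLayered x t L) (c : ℕ) :
    (markerPositions x t L {3} c).card ≤ (markerPositions x t L {2} c).card := by
  have key : ∀ i ∈ markerPositions x t L {3} c, FollowsEqual x t i := fun i hi => by
    obtain ⟨h1, h2, h3⟩ := mem_markerPositions.1 hi
    exact h.followsEqual i h1 h2
  choose! f hf using key
  refine Finset.card_le_card_of_injOn f (fun i hi => ?_) fun i hi i' hi' he => ?_
  · obtain ⟨h1, h2, h3⟩ := mem_markerPositions.1 hi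
    obtain ⟨g1, g2, g3, -⟩ := hf i hi
    exact mem_markerPositions.2 ⟨by omega, g2, by omega⟩
  · wlog hlt : i < i' generalizing i i'
    · rcases eq_or_lt_of_le (not_lt.1 hlt) with h' | h'
      · exact h'.symm
      · exact (this i' hi' i hi he.symm h').symm
    obtain ⟨h1, h2, h3⟩ := mem_markerPositions.1 hi
    obtain ⟨-, -, h3'⟩ := mem_markerPositions.1 hi'
    obtain ⟨g1, -⟩ := hf i hi
    obtain ⟨-, -, -, g4⟩ := hf i' hi'
    exact absurd (h3.trans h3'.symm) (g4 i (by omega) hlt (Or.inr h2))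

theorem card_markerPositions_add (c : ℕ) :
    (markerPositions x t L {2} c).card + (markerPositions x t L {3} c).card =
      (markerPositions x t L {2, 3} c).card := by
  rw [← Finset.card_union_of_disjoint]
  · congr 1
    ext i
    simp only [Finset.mem_union, mem_markerPositions, Set.mem_insert_iff, Set.mem_singleton_iff]
    tauto
  · refine Finset.disjoint_left.2 fun i h h' => ?_
    have h1 : x i = 2 := (mem_markerPositions.1 h).2.1
    have h2 : x i = 3 := (mem_markerPositions.1 h').2.1
    exact absurd (h1.symm.trans h2) (by decide)

theorem IsLayered.pow_mul_card_le (h : IsLayered x t L) (c : ℕ) :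
    2 ^ c * (markerPositions x t L {2, 3} c).card ≤ (markerPositions x t L {2, 3} 0).card := by
  induction c with
  | zero => simp
  | succ c ih =>
    refine le_trans ?_ ih
    rw [pow_succ, mul_assoc]
    gcongr
    have := h.card_succ_le c
    have := h.card_three_le c
    have := card_markerPositions_add (x := x) (t := t) (L := L) c
    omega

theorem IsLayered.two_pow_le (h : IsLayered x t L) : 2 ^ (2 ^ t - 1) ≤ L := by
  have hp := h.pos
  have h1 : 0 < (markerPositions x t L {2, 3} (2 ^ t - 1)).card :=
    Finset.card_pos.2 ⟨L - 1, mem_markerPositions.2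
      ⟨by omega, h.isMarker_last, by have := h.level_last; omega⟩⟩
  have h2 : (markerPositions x t L {2, 3} 0).card ≤ L := by
    exact (Finset.card_le_card fun i hi => Finset.mem_range.2 (mem_markerPositions.1 hi).1).trans
      (Finset.card_range L).le
  exact ((Nat.le_mul_of_pos_right _ h1).trans (h.pow_mul_card_le _)).trans h2

/-! ### The ternary ruler word -/

/-- The word made of blocks of `t` digits and one marker. The marker of the `m`-th block, `m ≥ 1`,
has as its level the exponent of `3` in `m` and tells the last nonzero ternary digit of `m`. -/
def rulerWord (t p : ℕ) : Fin 4 :=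
  let m := p / (t + 1) + 1
  let v := padicValNat 3 m
  if p % (t + 1) = t then if m / 3 ^ v % 3 = 1 then 2 else 3
  else if v / 2 ^ (t - 1 - p % (t + 1)) % 2 = 1 then 1 else 0

theorem div_mod_of_lt {t q r : ℕ} (hr : r < t + 1) :
    (q * (t + 1) + r) / (t + 1) = q ∧ (q * (t + 1) + r) % (t + 1) = r := by
  constructor
  · rw [mul_comm, Nat.mul_add_div (Nat.succ_pos t), Nat.div_eq_of_lt hr, add_zero]
  · rw [mul_comm, Nat.mul_add_mod, Nat.mod_eq_of_lt hr]

theorem tokenBit_rulerWord {t q r : ℕ} (hr : r < t) :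
    tokenBit (rulerWord t (q * (t + 1) + r)) =
      padicValNat 3 (q + 1) / 2 ^ (t - 1 - r) % 2 := by
  obtain ⟨h1, h2⟩ := div_mod_of_lt (t := t) (q := q) (r := r) (by omega)
  simp only [rulerWord, h1, h2, hr.ne, if_false]
  have := Nat.mod_two_eq_zero_or_one (padicValNat 3 (q + 1) / 2 ^ (t - 1 - r))
  rcases this with h | h <;> simp [h, tokenBit]

theorem rulerWord_marker (t q : ℕ) :
    rulerWord t (q * (t + 1) + t) =
      if (q + 1) / 3 ^ padicValNat 3 (q + 1) % 3 = 1 then 2 else 3 := by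
  obtain ⟨h1, h2⟩ := div_mod_of_lt (t := t) (q := q) (r := t) (by omega)
  simp only [rulerWord, h1, h2, if_true]

theorem isMarker_rulerWord_marker (t q : ℕ) : IsMarker (rulerWord t (q * (t + 1) + t)) := by
  rw [rulerWord_marker]
  unfold IsMarker
  split <;> simp

theorem exists_of_isMarker_rulerWord {t p : ℕ} (h : IsMarker (rulerWord t p)) :
    ∃ q, p = q * (t + 1) + t := by
  refine ⟨p / (t + 1), ?_⟩
  by_cases hp : p % (t + 1) = t
  · conv_lhs => rw [← Nat.div_add_mod p (t + 1), hp, mul_comm]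
  · exfalso
    simp only [rulerWord, hp, if_false, IsMarker] at h
    split at h <;> simp at h

/-- Digits stand most significant first, so a window of `u` digits that ends at offset `u + d` of a
block shows the lowest `u` bits of the valuation shifted right by `t - (u + d)`. The start offset
`d` stays fixed in the induction, so the window never leaves the block. -/
theorem level_rulerWord_aux {t q : ℕ} : ∀ u d : ℕ, u + d ≤ t →
    level (rulerWord t) u (q * (t + 1) + (u + d)) =
      padicValNat 3 (q + 1) / 2 ^ (t - (u + d)) % 2 ^ u
  | 0, d, _ => by simp [level, Nat.mod_one]
  | u + 1, d, h => by
    have e : q * (t + 1) + (u + 1 + d) = (q * (t + 1) + (u + d)) + 1 := by ring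
    rw [e, level, tokenBit_rulerWord (by omega), level_rulerWord_aux u d (by omega)]
    have e1 : t - 1 - (u + d) = t - (u + 1 + d) := by omega
    have e2 : t - (u + d) = t - (u + 1 + d) + 1 := by omega
    rw [e1, e2, pow_succ 2 (t - (u + 1 + d)), ← Nat.div_div_eq_div_mul, pow_succ' 2 u,
      Nat.mod_mul]

theorem level_rulerWord {t q : ℕ} (h : padicValNat 3 (q + 1) < 2 ^ t) :
    level (rulerWord t) t (q * (t + 1) + t) = padicValNat 3 (q + 1) := by
  have := level_rulerWord_aux (t := t) (q := q) t 0 (by omega)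
  simpa [Nat.mod_eq_of_lt h] using this

theorem padicValNat_three_pow_mul {c a : ℕ} (ha : ¬ 3 ∣ a) : padicValNat 3 (3 ^ c * a) = c := by
  have : a ≠ 0 := by rintro rfl; simp at ha
  rw [padicValNat.mul (by positivity) this, padicValNat.prime_pow,
    padicValNat.eq_zero_of_not_dvd ha, add_zero]

theorem padicValNat_three_lt {q N : ℕ} (h : q < 3 ^ N) : padicValNat 3 (q + 1) ≤ N := by
  have h1 : 3 ^ padicValNat 3 (q + 1) ∣ q + 1 := pow_padicValNat_dvd
  have h2 := Nat.le_of_dvd (Nat.succ_pos q) h1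
  exact (Nat.pow_le_pow_iff_right (by norm_num : 1 < 3)).1 (h2.trans h)

/-- The markers strictly between the blocks `3 ^ c * a` and `3 ^ c * (a + 1)` have levels
below `c`. -/
theorem padicValNat_three_lt_of_between {c a m : ℕ} (h1 : 3 ^ c * a < m)
    (h2 : m < 3 ^ c * (a + 1)) : padicValNat 3 m < c := by
  by_contra! h
  obtain ⟨k, rfl⟩ : 3 ^ c ∣ m := (pow_dvd_pow 3 h).trans pow_padicValNat_dvd
  have h1' := Nat.lt_of_mul_lt_mul_left h1
  have h2' := Nat.lt_of_mul_lt_mul_left h2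
  omega

/-- Before block 3 ^ c * (a + 1), the nearest block of level at least c is 3 ^ c * a. If 3 does not
divide a, its level is exactly c and its marker is read off from a mod 3. Both conditions are
instances of this. -/
theorem isLayered_rulerWord (t : ℕ) :
    IsLayered (rulerWord t) t ((t + 1) * 3 ^ (2 ^ t - 1)) := by
  set N := 2 ^ t - 1 with hN
  have hNt : N + 1 = 2 ^ t := Nat.sub_add_cancel Nat.one_le_two_pow
  have hlev : ∀ {q}, q * (t + 1) + t < (t + 1) * 3 ^ N →
      level (rulerWord t) t (q * (t + 1) + t) = padicValNat 3 (q + 1) := fun {q} hq => by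
    have : q < 3 ^ N := by
      by_contra! hc
      have := Nat.mul_le_mul_left (t + 1) hc
      rw [mul_comm (t + 1) q] at this
      omega
    exact level_rulerWord (by have := padicValNat_three_lt this; omega)
  -- the rightmost marker of level at least `c` before block `3 ^ c * (a + 1)`
  have prev : ∀ {q c a}, q * (t + 1) + t < (t + 1) * 3 ^ N → q + 1 = 3 ^ c * (a + 1) →
      ¬ 3 ∣ a → ∃ j < q * (t + 1) + t, (rulerWord t j = if a % 3 = 1 then 2 else 3) ∧
        level (rulerWord t) t j = c ∧
        ∀ k, j < k → k < q * (t + 1) + t → IsMarker (rulerWord t k) →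
          level (rulerWord t) t k < c := by
    intro q c a hq he ha
    have hpos : 0 < 3 ^ c * a := Nat.mul_pos (by positivity) (by omega)
    obtain ⟨q', hq'⟩ : ∃ q', q' + 1 = 3 ^ c * a := ⟨3 ^ c * a - 1, by omega⟩
    have hlt : q' < q := by
      have : q' + 1 < q + 1 := by
        rw [hq', he]
        exact Nat.mul_lt_mul_of_pos_left (by omega) (by positivity)
      omega
    have hlt' : q' * (t + 1) + t < q * (t + 1) + t := by
      have := Nat.mul_lt_mul_of_pos_right hlt (show 0 < t + 1 from Nat.succ_pos t)
      omega
    refine ⟨q' * (t + 1) + t, hlt', ?_, ?_, ?_⟩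
    · rw [rulerWord_marker, hq', padicValNat_three_pow_mul ha,
        Nat.mul_div_cancel_left _ (by positivity)]
    · rw [hlev (hlt'.trans hq), hq', padicValNat_three_pow_mul ha]
    · intro k hk1 hk2 hk
      obtain ⟨q'', rfl⟩ := exists_of_isMarker_rulerWord hk
      rw [hlev (hk2.trans hq)]
      have g1 : q' < q'' := by
        by_contra! hc
        have := Nat.mul_le_mul_right (t + 1) hc
        omega
      have g2 : q'' < q := by
        by_contra! hc
        have := Nat.mul_le_mul_right (t + 1) hc
        omega
      exact padicValNat_three_lt_of_between (a := a) (by omega) (by omega)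
  have factor : ∀ q, ∃ b, q + 1 = 3 ^ padicValNat 3 (q + 1) * b ∧ ¬ 3 ∣ b := fun q => by
    obtain ⟨b, hb⟩ : 3 ^ padicValNat 3 (q + 1) ∣ q + 1 := pow_padicValNat_dvd
    refine ⟨b, hb, fun h => ?_⟩
    refine pow_succ_padicValNat_not_dvd (p := 3) (n := q + 1) (Nat.succ_ne_zero q) ?_
    rw [pow_succ]
    conv_rhs => rw [hb]
    exact Nat.mul_dvd_mul_left _ h
  have hlast : (t + 1) * 3 ^ N - 1 = (3 ^ N - 1) * (t + 1) + t := by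
    obtain ⟨k, hk⟩ : ∃ k, 3 ^ N = k + 1 := 
      ⟨3 ^ N - 1, (Nat.sub_add_cancel (Nat.one_le_pow _ _ (by norm_num))).symm⟩
    rw [hk, Nat.add_sub_cancel]
    have : (t + 1) * (k + 1) = k * (t + 1) + t + 1 := by ring
    omega
  have hpos : 0 < (t + 1) * 3 ^ N := by positivity
  refine ⟨fun i hi hm h0 => ?_, fun i hi h3 => ?_, hpos, ?_, ?_⟩
  · obtain ⟨q, rfl⟩ := exists_of_isMarker_rulerWord hm
    rw [hlev hi] at h0
    obtain ⟨b, hb, hb3⟩ := factor q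
    obtain ⟨c, hc⟩ : ∃ c, padicValNat 3 (q + 1) = c + 1 := ⟨_, (Nat.succ_pred h0).symm⟩
    rw [hc] at hb
    -- Viewed one level lower, the block is 3 ^ c * (3b), and 3b - 1 is 2 mod 3: the preceding
    -- marker is a `3` of level c.
    obtain ⟨a, ha⟩ : ∃ a, 3 * b = a + 1 := ⟨3 * b - 1, by omega⟩
    obtain ⟨j, hj, hj1, hj2, hj3⟩ := prev (c := c) (a := a) hi
      (by rw [hb, pow_succ, mul_assoc, ha]) (by omega)
    refine ⟨j, hj, ?_, ?_, fun k h1 h2 h3 => ?_⟩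
    · rw [hj1, if_neg (by omega)]
    · rw [hj2, hlev hi, hc]
    · have := hj3 k h1 h2 h3
      rw [hlev hi, hc]
      omega
  · obtain ⟨q, rfl⟩ := exists_of_isMarker_rulerWord (Or.inr h3)
    obtain ⟨b, hb, hb3⟩ := factor q
    have hb2 : b % 3 = 2 := by
      rw [rulerWord_marker] at h3
      conv at h3 => enter [1, 1, 1, 1, 1]; rw [hb]
      rw [Nat.mul_div_cancel_left _ (by positivity)] at h3
      split at h3
      · exact absurd h3 (by decide)
      · omega
    -- As b is 2 mod 3, b - 1 is 1 mod 3: the preceding marker of this level is a `2`.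
    obtain ⟨a, rfl⟩ : ∃ a, b = a + 1 := ⟨b - 1, by omega⟩
    obtain ⟨j, hj, hj1, hj2, hj3⟩ := prev (a := a) hi hb (by omega)
    refine ⟨j, hj, ?_, ?_, fun k h1 h2 h3 => ?_⟩
    · rw [hj1, if_pos (by omega)]
    · rw [hj2, hlev hi]
    · have := hj3 k h1 h2 h3
      rw [hlev hi]
      omega
  · rw [hlast]
    exact isMarker_rulerWord_marker _ _
  · rw [hlast, hlev (by omega), Nat.sub_add_cancel (Nat.one_le_pow _ _ (by norm_num)),
      padicValNat.prime_pow, hNt]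

end MarkedWords

/-! ### Attention layers from linear maps -/

/-- The affine transformation with given linear part and constant part. -/
noncomputable def RatAffine.ofLinear {m n : ℕ} (f : (Fin m → ℚ) →ₗ[ℚ] (Fin n → ℚ))
    (b : Fin n → ℚ) : RatAffine m n :=
  ⟨LinearMap.toMatrix' f, b⟩

@[simp] theorem RatAffine.ofLinear_apply {m n : ℕ} (f : (Fin m → ℚ) →ₗ[ℚ] (Fin n → ℚ))
    (b : Fin n → ℚ) (x : Fin m → ℚ) : (RatAffine.ofLinear f b).apply x = f x + b := by
  simp [RatAffine.ofLinear, RatAffine.apply, LinearMap.toMatrix'_mulVec]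

/-- The two halves of a vector. -/
def splitVec (m n : ℕ) : (Fin (m + n) → ℚ) →ₗ[ℚ] (Fin m → ℚ) × (Fin n → ℚ) where
  toFun x := (fun i => x (Fin.castAdd n i), fun i => x (Fin.natAdd m i))
  map_add' _ _ := rfl
  map_smul' _ _ := rfl

@[simp] theorem splitVec_append {m n : ℕ} (v : Fin m → ℚ) (a : Fin n → ℚ) :
    splitVec m n (Fin.append v a) = (v, a) := by
  ext i <;> simp [splitVec]

namespace AttentionLayer

variable {r s n : ℕ} (ℓ : AttentionLayer r s) (v : Fin n → Fin r → ℚ)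

theorem attentionVector_of_none (hm : ℓ.mask = .none) (i : Fin n) :
    ∃ j, ℓ.attentionVector v i = v j ∧ ∀ j', ℓ.score v i j' ≤ ℓ.score v i j := by
  have hu : ∀ j, j ∈ ℓ.unmasked i := fun j => by simp [unmasked, hm, Mask.allows]
  have hne : (ℓ.unmasked i).Nonempty := ⟨i, hu i⟩
  have hmem : ℓ.tie.select (ℓ.best v i) (ℓ.best_nonempty v i hne) ∈ ℓ.best v i := by
    cases ℓ.tie
    · exact Finset.min'_mem _ _
    · exact Finset.max'_mem _ _
  refine ⟨_, by rw [attentionVector, dif_pos hne], fun j' => ?_⟩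
  exact (Finset.mem_filter.1 hmem).2 j' (hu j')

theorem attentionVector_of_first (hm : ℓ.mask = .strictFuture) (i : Fin n) (hi : (i : ℕ) = 0) :
    ℓ.attentionVector v i = 0 := by
  rw [attentionVector, dif_neg]
  rintro ⟨j, hj⟩
  simp only [unmasked, hm, Mask.allows, Finset.mem_filter] at hj
  have : (j : ℕ) < i := hj.2
  omega

theorem attentionVector_of_strictFuture (hm : ℓ.mask = .strictFuture) (ht : ℓ.tie = .rightmost)
    (i : Fin n) (hi : (i : ℕ) ≠ 0) :
    ∃ j < i, ℓ.attentionVector v i = v j ∧ (∀ j' < i, ℓ.score v i j' ≤ ℓ.score v i j) ∧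
      ∀ j' < i, j < j' → ℓ.score v i j' < ℓ.score v i j := by
  have hu : ∀ j, j ∈ ℓ.unmasked i ↔ j < i := fun j => by simp [unmasked, hm, Mask.allows]
  have hne : (ℓ.unmasked i).Nonempty :=
    ⟨⟨0, i.pos⟩, (hu _).2 (Fin.lt_def.2 (Nat.pos_of_ne_zero hi))⟩
  have hb := ℓ.best_nonempty v i hne
  have hsel : ℓ.tie.select (ℓ.best v i) hb = (ℓ.best v i).max' hb := by
    rw [ht]; rfl
  have hmem := Finset.mem_filter.1 ((ℓ.best v i).max'_mem hb)
  refine ⟨(ℓ.best v i).max' hb, (hu _).1 hmem.1, by rw [attentionVector, dif_pos hne, hsel],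
    fun j' hj' => hmem.2 j' ((hu j').2 hj'), fun j' hj' hlt => ?_⟩
  refine lt_of_le_of_ne (hmem.2 j' ((hu j').2 hj')) fun he => ?_
  have : j' ∈ ℓ.best v i :=
    Finset.mem_filter.2 ⟨(hu j').2 hj', fun j'' hj'' => he ▸ hmem.2 j'' hj''⟩
  exact absurd (Finset.le_max' _ _ this) (not_le.2 hlt)

end AttentionLayer

/-! ### The layers -/

/-- Vectors with eight coordinates: a digit and its complement times `2 ^ t`, the level,
two numbers `y` and `s` for which `s + 4 * y` is the square of the level, the number `2 ^ t`, and
two flags for the two kinds of markers. -/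
abbrev StateVec := Fin 8 → ℚ

/-- A coordinate of the vector at the current position. -/
def own (i : Fin 8) : StateVec × StateVec →ₗ[ℚ] ℚ :=
  LinearMap.proj i ∘ₗ LinearMap.fst ℚ _ _

/-- A coordinate of the attention vector. -/
def att (i : Fin 8) : StateVec × StateVec →ₗ[ℚ] ℚ :=
  LinearMap.proj i ∘ₗ LinearMap.snd ℚ _ _

@[simp] theorem att_apply (i : Fin 8) (v a : StateVec) : att i (v, a) = a i := rfl

def coord (i : Fin 8) : StateVec →ₗ[ℚ] ℚ := LinearMap.proj i

@[simp] theorem coord_apply (i : Fin 8) (v : StateVec) : coord i v = v i := rfl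

/-- The attention layer with score `f v_j + β + (h v_i + γ) * g v_j`. -/
noncomputable def stateLayer {s : ℕ} (f : StateVec →ₗ[ℚ] ℚ) (β : ℚ) (h : StateVec →ₗ[ℚ] ℚ)
    (γ : ℚ) (g : StateVec →ₗ[ℚ] ℚ) (out : Fin s → StateVec × StateVec →ₗ[ℚ] ℚ) (c : Fin s → ℚ)
    (mask : Mask) : AttentionLayer 8 s where
  width_pos := by norm_num
  A := .ofLinear (LinearMap.pi ![0, h, 0, 0, 0, 0, 0, 0]) ![1, γ, 0, 0, 0, 0, 0, 0]
  B := .ofLinear (LinearMap.pi ![f, g, 0, 0, 0, 0, 0, 0]) ![β, 0, 0, 0, 0, 0, 0, 0]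
  C := .ofLinear (LinearMap.pi out ∘ₗ splitVec 8 8) c
  mask := mask
  tie := .rightmost

section stateLayer

variable {s n : ℕ} (f : StateVec →ₗ[ℚ] ℚ) (β : ℚ) (h : StateVec →ₗ[ℚ] ℚ)
    (γ : ℚ) (g : StateVec →ₗ[ℚ] ℚ) (out : Fin s → StateVec × StateVec →ₗ[ℚ] ℚ) (c : Fin s → ℚ)
    (mask : Mask) (v : Fin n → StateVec)

theorem stateLayer_score (i j : Fin n) :
    (stateLayer f β h γ g out c mask).score v i j =
      f (v j) + β + (h (v i) + γ) * g (v j) := by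
  simp [AttentionLayer.score, stateLayer, dotProduct, Fin.sum_univ_succ]

theorem stateLayer_eval (i : Fin n) (k : Fin s) :
    (stateLayer f β h γ g out c mask).eval v i k =
      out k (v i, (stateLayer f β h γ g out c mask).attentionVector v i) + c k := by
  simp only [AttentionLayer.eval]
  rw [show (stateLayer f β h γ g out c mask).C =
    .ofLinear (LinearMap.pi out ∘ₗ splitVec 8 8) c from rfl]
  simp only [RatAffine.ofLinear_apply, Pi.add_apply, LinearMap.comp_apply, LinearMap.pi_apply]
  rw [splitVec_append]

end stateLayer

/-- The layer that moves the digits and the levels by one position to the right. -/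
noncomputable def prevLayer : AttentionLayer 8 8 :=
  stateLayer 0 0 0 0 0
    -- For the digit b ∈ {0, 1} and level l of the previous position, (b + 2l)² = b + 4l² + 4bl.
    -- Substituting l² = s + 4y gives coordinate 4. Coordinate 3 is l - (1 - b) * 2 ^ t, whose ReLU
    -- is bl because l < 2 ^ t. Doubling coordinates 1 and 5 maintains the powers of 2 with
    -- coefficients independent of `t`.
    ![own 0, (2 : ℚ) • own 1, att 0 + (2 : ℚ) • att 2, att 2 - att 1,
      att 0 + (4 : ℚ) • att 4 + (16 : ℚ) • att 3, (2 : ℚ) • own 5, own 6, own 7] 0 .strictFuture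

/-- The layer in which a position of level `c` attends to the rightmost earlier marker whose level
maximizes `(2 * c - δ) * x - x ^ 2`. -/
noncomputable def queryLayer (δ : ℚ) (out : Fin 8 → StateVec × StateVec →ₗ[ℚ] ℚ)
    (c : Fin 8 → ℚ) : AttentionLayer 8 8 :=
  -- The flags together with -1 cost every non-marker one point; coordinates 4 and 3 contribute the
  -- negative square of the level.
  stateLayer (coord 6 + coord 7 - coord 4 - (4 : ℚ) • coord 3) (-1) ((2 : ℚ) • coord 2) (-δ)
    (coord 2) out c .strictFuture

/-- A layer that ignores the attention vector. -/
noncomputable def affineLayer (out : Fin 8 → StateVec × StateVec →ₗ[ℚ] ℚ) (c : Fin 8 → ℚ) :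
    AttentionLayer 8 8 :=
  stateLayer 0 0 0 0 0 out c .none

/-- With d = own level - attended level - 1 and p the flag for an attended `3`, coordinates 0 and 1
are d + 1 - p and -d + 1 - p, the inputs of `relu_test_eq`. -/
noncomputable def lowerLayer : AttentionLayer 8 8 :=
  queryLayer 1 ![own 2 - att 2 - att 7, att 2 - own 2 - att 7, own 2, own 3, own 4, own 5, own 6,
    own 7] ![0, 2, 0, 0, 0, 0, 0, 0]

noncomputable def lowerTestLayer : AttentionLayer 8 8 :=
  affineLayer ![- own 0 - own 1, - own 2, own 2, own 3, own 4, own 5, own 6, own 7]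
    ![1, 1, 0, 0, 0, 0, 0, 0]

/-- After ReLU, coordinate 0 flags a violation of the first condition. Coordinates 1 and 3 hold the
two inputs of the second test; the square of the level may be discarded, since no later layer
queries levels. -/
noncomputable def equalLayer : AttentionLayer 8 8 :=
  queryLayer 0 ![own 6 + own 7 - own 0 - own 1, own 2 - att 2 - att 6, own 2, att 2 - own 2 - att 6,
    0, own 5, own 6, own 7] ![0, 1, 0, 1, 0, 0, 0, 0]

noncomputable def equalTestLayer : AttentionLayer 8 8 :=
  affineLayer ![own 0, - own 1 - own 3, own 2, 0, 0, own 5, own 6, own 7] ![0, 1, 0, 0, 0, 0, 0, 0]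

noncomputable def errorLayer : AttentionLayer 8 8 :=
  affineLayer ![own 0, own 7 - own 1, own 2, 0, 0, own 5, own 6, own 7] 0

/-- The layer that finds an error at any position and tests the marker at the current position. -/
noncomputable def finalLayer : AttentionLayer 8 1 :=
  -- The output is (level + 1 - 2 ^ t) + marker flag - largest error. The first term is an integer
  -- at most 0 and the flag is at most 1, so positivity forces highest level, a marker, and no error
  -- anywhere.
  stateLayer (coord 0 + coord 1) 0 0 0 0 ![own 2 - own 5 + own 6 + own 7 - att 0 - att 1] 1 .none

/-- The layers that compute the levels. -/
noncomputable def levelLayers {s : ℕ} : ℕ → LayerSeq 8 s → LayerSeq 8 s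
  | 0, L => L
  | t + 1, L => .attention prevLayer (.relu 3 (levelLayers t L))

/-- The layers that test the conditions on the markers. -/
noncomputable def testLayers : LayerSeq 8 1 :=
  .attention lowerLayer <| .relu 0 <| .relu 1 <|
  .attention lowerTestLayer <| .relu 0 <| .relu 1 <|
  .attention equalLayer <| .relu 0 <| .relu 1 <| .relu 3 <|
  .attention equalTestLayer <| .relu 1 <|
  .attention errorLayer <| .relu 1 <|
  .attention finalLayer <| .nil 1

/-- A transformer for the words with marker levels of `t` binary digits. -/
noncomputable def layeredUHAT (t : ℕ) : UHAT 4 where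
  d := 8
  d_pos := by norm_num
  emb a := ![tokenBit a, 1 - tokenBit a, 0, 0, 0, 1, if a = 2 then 1 else 0, if a = 3 then 1 else 0]
  s := 1
  layers := levelLayers t testLayers
  acceptVec := 1
  output := .last

theorem LayerSeq.length_code_attention {r s t : ℕ} (ℓ : AttentionLayer r s) (L : LayerSeq s t) :
    (LayerSeq.attention ℓ L).code.length = 2 + ℓ.code.length + L.code.length := by
  rw [LayerSeq.code, List.length_append, List.length_append]
  rfl

theorem LayerSeq.length_code_relu {r t : ℕ} (k : Fin r) (L : LayerSeq r t) :
    (LayerSeq.relu k L).code.length = 2 + (natCode k).length + L.code.length := by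
  rw [LayerSeq.code, List.length_append, List.length_append]
  rfl

theorem length_code_levelLayers {s : ℕ} (t : ℕ) (L : LayerSeq 8 s) :
    (levelLayers t L).code.length =
      L.code.length + (prevLayer.code.length + (natCode (3 : Fin 8)).length + 4) * t := by
  induction t with
  | zero => rw [levelLayers, Nat.mul_zero, Nat.add_zero]
  | succ t ih =>
    rw [levelLayers, LayerSeq.length_code_attention, LayerSeq.length_code_relu, ih]
    ring

theorem UHAT.size_eq {k : ℕ} (T : UHAT k) :
    T.size = (natCode k ++ natCode T.d ++ ((List.finRange k).flatMap fun a =>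
      vecCode (T.emb a))).length + T.layers.code.length +
        (vecCode T.acceptVec ++ T.output.code).length := by
  simp only [UHAT.size, UHAT.code, List.length_append]
  ring

/-- Only the number of copies of one fixed pair of layers depends on `t`; no weight does. -/
theorem size_layeredUHAT (t : ℕ) :
    (layeredUHAT t).size = (layeredUHAT 0).size +
      (prevLayer.code.length + (natCode (3 : Fin 8)).length + 4) * t := by
  rw [UHAT.size_eq, UHAT.size_eq]
  have h : ∀ t, (layeredUHAT t).layers.code.length = testLayers.code.length +
      (prevLayer.code.length + (natCode (3 : Fin 8)).length + 4) * t :=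
    fun t => length_code_levelLayers t testLayers
  rw [h, h, Nat.mul_zero]
  simp only [layeredUHAT]
  ring

/-! ### Correctness of the layers -/

/-- The vectors contain the levels and the markers of a word. -/
structure HasLevels {n : ℕ} (x : ℕ → Fin 4) (t : ℕ) (v : Fin n → StateVec) : Prop where
  value : ∀ i, v i 2 = level x t i
  square : ∀ i, v i 4 + 4 * v i 3 = (level x t i : ℚ) ^ 2
  width : ∀ i, v i 5 = 2 ^ t
  two : ∀ i, v i 6 = if x i = 2 then 1 else 0
  three : ∀ i, v i 7 = if x i = 3 then 1 else 0

/-- The vectors after `t` of the layers that compute the levels. -/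
structure IsState {n : ℕ} (x : ℕ → Fin 4) (t : ℕ) (v : Fin n → StateVec) : Prop
    extends HasLevels x t v where
  bit : ∀ i, v i 0 = tokenBit (x i)
  cobit : ∀ i, v i 1 = (1 - tokenBit (x i)) * 2 ^ t

section Correctness

variable {n : ℕ} {x : ℕ → Fin 4} {t : ℕ} {v : Fin n → StateVec}

theorem reluLayer_apply_self {r n : ℕ} (k : Fin r) (v : Fin n → Fin r → ℚ) (i : Fin n) :
    reluLayer k v i k = max 0 (v i k) := by simp [reluLayer]

theorem reluLayer_apply_of_ne {r n : ℕ} {k k' : Fin r} (h : k' ≠ k) (v : Fin n → Fin r → ℚ)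
    (i : Fin n) : reluLayer k v i k' = v i k' := by simp [reluLayer, h]

theorem prevLayer_attentionVector_zero (i : Fin n) (hi : (i : ℕ) = 0) :
    prevLayer.attentionVector v i = 0 :=
  prevLayer.attentionVector_of_first v rfl i hi

/-- All scores are 0, so rightmost tie-breaking under the mask selects the immediate predecessor. -/
theorem prevLayer_attentionVector_succ (i : Fin n) (j : ℕ) (hi : (i : ℕ) = j + 1) :
    prevLayer.attentionVector v i = v ⟨j, by omega⟩ := by
  obtain ⟨k, hk, he, -, hlast⟩ :=
    prevLayer.attentionVector_of_strictFuture v rfl rfl i (by omega)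
  rw [he]
  congr 1
  by_contra hne
  have h1 : (k : ℕ) < i := hk
  have h2 : (k : ℕ) ≠ j := fun h => hne (Fin.ext h)
  have := hlast ⟨j, by omega⟩ (Fin.lt_def.2 (by simp; omega)) (Fin.lt_def.2 (by simp; omega))
  simp [prevLayer, stateLayer_score] at this

theorem IsState.step (h : IsState x t v) :
    IsState x (t + 1) (reluLayer 3 (prevLayer.eval v)) := by
  have e3 : ∀ i, reluLayer 3 (prevLayer.eval v) i 3 = max 0 (prevLayer.eval v i 3) :=
    fun i => reluLayer_apply_self _ _ _
  have ev : ∀ i k, prevLayer.eval v i k = _ := fun i k => stateLayer_eval ..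
  have hb : ∀ a, tokenBit a = 0 ∨ tokenBit a = 1 := fun a => by
    have := tokenBit_le_one a
    omega
  refine ⟨⟨fun i => ?_, fun i => ?_, fun i => ?_, fun i => ?_, fun i => ?_⟩, fun i => ?_,
    fun i => ?_⟩
  · rw [reluLayer_apply_of_ne (by decide), ev]
    change att 0 (v i, prevLayer.attentionVector v i) +
      2 * att 2 (v i, prevLayer.attentionVector v i) + 0 = _
    -- At the first position the attention vector defaults to 0, in agreement with `level` there.
    rcases hi : (i : ℕ) with _ | j
    · rw [prevLayer_attentionVector_zero i hi]
      simp [level]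
    · rw [prevLayer_attentionVector_succ i j hi]
      simp [level, h.value, h.bit]
  · rw [reluLayer_apply_of_ne (by decide), e3, ev, ev]
    change att 0 (v i, prevLayer.attentionVector v i) +
      4 * att 4 (v i, prevLayer.attentionVector v i) +
      16 * att 3 (v i, prevLayer.attentionVector v i) + 0 +
      4 * max 0 (att 2 (v i, prevLayer.attentionVector v i) -
        att 1 (v i, prevLayer.attentionVector v i) + 0) = _
    rcases hi : (i : ℕ) with _ | j
    · rw [prevLayer_attentionVector_zero i hi]
      simp [level]
    · rw [prevLayer_attentionVector_succ i j hi]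
      have hsq := h.square ⟨j, by omega⟩
      have hlt : (level x t j : ℚ) < 2 ^ t := by exact_mod_cast level_lt x t j
      simp only [att_apply, level, h.value, h.bit, h.cobit] at hsq ⊢
      rcases hb (x j) with hx | hx
      · rw [hx, max_eq_left (by push_cast; linarith)]
        push_cast
        linarith
      · rw [hx, max_eq_right (by push_cast; simp)]
        push_cast
        linarith
  · rw [reluLayer_apply_of_ne (by decide), ev]
    change 2 * v i 5 + 0 = _
    rw [h.width]
    ring
  · rw [reluLayer_apply_of_ne (by decide), ev]
    change v i 6 + 0 = _
    rw [h.two, add_zero]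
  · rw [reluLayer_apply_of_ne (by decide), ev]
    change v i 7 + 0 = _
    rw [h.three, add_zero]
  · rw [reluLayer_apply_of_ne (by decide), ev]
    change v i 0 + 0 = _
    rw [h.bit, add_zero]
  · rw [reluLayer_apply_of_ne (by decide), ev]
    change 2 * v i 1 + 0 = _
    rw [h.cobit]
    ring

theorem IsState.eval_levelLayers {s : ℕ} (L : LayerSeq 8 s) (u : ℕ) (h : IsState x t v) :
    ∃ v', IsState x (t + u) v' ∧ (levelLayers u L).eval v = L.eval v' := by
  induction u generalizing t v with
  | zero => exact ⟨v, h, rfl⟩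
  | succ u ih =>
    obtain ⟨v', h1, h2⟩ := ih h.step
    exact ⟨v', by rwa [add_right_comm, add_assoc] at h1, h2⟩

end Correctness

/-! ### Correctness of the tests -/

section Tests

variable {n : ℕ} {x : ℕ → Fin 4} {t : ℕ} {v : Fin n → StateVec}

/-- The bound `top` need not be attained. If there is no hit before i, the attended position is
uncontrolled, but it is not a hit, so `Q` fails there as it should. Testing `Q` at the attended
position is therefore always conclusive. -/
theorem rightmost_argmax_iff {i j : Fin n} {σ : Fin n → ℚ} {hit Q : ℕ → Prop} {top : ℚ}
    (hσ : ∀ k, σ k ≤ top) (hhit : ∀ k : Fin n, σ k = top ↔ hit k) (hQ : ∀ k, Q k → hit k)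
    (hj : j < i) (hmax : ∀ k < i, σ k ≤ σ j) (hlast : ∀ k < i, j < k → σ k < σ j) :
    Q j ↔ ∃ m < (i : ℕ), Q m ∧ ∀ k, m < k → k < i → ¬ hit k := by
  constructor
  · intro h
    refine ⟨j, hj, h, fun k h1 h2 hk => ?_⟩
    have hkt := (hhit ⟨k, h2.trans i.2⟩).2 hk
    have hjt := (hhit j).2 (hQ _ h)
    have := hlast ⟨k, h2.trans i.2⟩ h2 h1
    rw [hkt, hjt] at this
    exact lt_irrefl _ this
  · rintro ⟨m, hm, hQm, hno⟩
    have hmt := (hhit ⟨m, hm.trans i.2⟩).2 (hQ _ hQm)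
    rcases lt_trichotomy m (j : ℕ) with h | h | h
    · have h1 := hmax ⟨m, hm.trans i.2⟩ hm
      rw [hmt] at h1
      exact absurd ((hhit j).1 (le_antisymm (hσ j) h1)) (hno j h hj)
    · exact h ▸ hQm
    · have h1 := hlast ⟨m, hm.trans i.2⟩ hm h
      rw [hmt] at h1
      exact absurd (hσ j) (not_le.2 h1)

theorem HasLevels.queryLayer_score (h : HasLevels x t v) (δ : ℚ)
    (out : Fin 8 → StateVec × StateVec →ₗ[ℚ] ℚ) (c : Fin 8 → ℚ) (i j : Fin n) :
    (queryLayer δ out c).score v i j =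
      (if x j = 2 then 1 else 0) + (if x j = 3 then 1 else 0) - 1 - (level x t j : ℚ) ^ 2 +
        (2 * level x t i - δ) * level x t j := by
  rw [queryLayer, stateLayer_score]
  have := h.square j
  simp only [LinearMap.sub_apply, LinearMap.add_apply, LinearMap.smul_apply, coord_apply,
    smul_eq_mul, h.value, h.two, h.three]
  linarith

theorem flags_eq (a : Fin 4) [Decidable (IsMarker a)] :
    ((if a = 2 then 1 else 0) + (if a = 3 then 1 else 0) : ℚ) = if IsMarker a then 1 else 0 := by
  by_cases h2 : a = 2
  · subst h2
    simp [IsMarker]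
  · by_cases h3 : a = 3 <;> simp [IsMarker, h2, h3]

/-- Integrality matters: no integer lies strictly between the zeros -1 and 0. Hence the score with δ
= 1 peaks at exactly two levels, that of i and the one below. -/
theorem mul_add_one_nonneg_int (d : ℤ) : 0 ≤ d * (d + 1) := by
  rcases le_or_gt 0 d with h | h
  · positivity
  · exact mul_nonneg_of_nonpos_of_nonpos (by omega) (by omega)

open Classical in
/-- The attention vector of `lowerLayer`. -/
theorem HasLevels.lowerLayer_attentionVector (h : HasLevels x t v) (i : Fin n) :
    ∃ (m : ℕ) (a : Fin 4), lowerLayer.attentionVector v i 2 = m ∧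
      lowerLayer.attentionVector v i 7 = (if a = 3 then 1 else 0) ∧
      ((a = 3 ∧ m + 1 = level x t i) ↔ FollowsLower x t i) := by
  by_cases hi : (i : ℕ) = 0
  · rw [lowerLayer.attentionVector_of_first v rfl i hi]
    -- The default zero vector is read as a digit `0` of level 0, which fails the test.
    refine ⟨0, 0, by simp, by simp, ?_⟩
    simp [FollowsLower, hi]
  · obtain ⟨j, hj, he, hmax, hlast⟩ := lowerLayer.attentionVector_of_strictFuture v rfl rfl i hi
    rw [he]
    refine ⟨level x t j, x j, h.value j, h.three j, ?_⟩
    have hs : ∀ k : Fin n, lowerLayer.score v i k =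
        (level x t i : ℚ) * (level x t i - 1) - (if IsMarker (x k) then 0 else 1) -
          (((level x t k - level x t i : ℤ) * ((level x t k - level x t i : ℤ) + 1) : ℤ) : ℚ) :=
      fun k => by
        rw [lowerLayer, h.queryLayer_score, flags_eq]
        push_cast
        split <;> ring
    have hnn : ∀ k : Fin n, (0 : ℚ) ≤
        (((level x t k - level x t i : ℤ) * ((level x t k - level x t i : ℤ) + 1) : ℤ) : ℚ) :=
      fun k => by exact_mod_cast mul_add_one_nonneg_int _
    refine (rightmost_argmax_iff (top := (level x t i : ℚ) * (level x t i - 1))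
      (Q := fun k => x k = 3 ∧ level x t k + 1 = level x t i)
      (hit := fun k => IsMarker (x k) ∧
        (level x t k = level x t i ∨ level x t k + 1 = level x t i))
      (fun k => ?_) (fun k => ?_) (fun k hk => ⟨Or.inr hk.1, Or.inr hk.2⟩) hj hmax hlast).trans ?_
    · rw [hs]
      have := hnn k
      split <;> linarith
    · rw [hs]
      have := hnn k
      by_cases hm : IsMarker (x k)
      · rw [if_pos hm]
        simp only [hm, true_and, sub_zero, sub_eq_self, Int.cast_eq_zero, mul_eq_zero]
        omega
      · rw [if_neg hm]
        simp only [hm, false_and, iff_false]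
        intro h'
        linarith
    · simp only [FollowsLower, not_and, not_or, and_assoc, ne_eq]

open Classical in
/-- The attention vector of `equalLayer`. -/
theorem HasLevels.equalLayer_attentionVector (h : HasLevels x t v) (i : Fin n) :
    ∃ (m : ℕ) (a : Fin 4), equalLayer.attentionVector v i 2 = m ∧
      equalLayer.attentionVector v i 6 = (if a = 2 then 1 else 0) ∧
      ((a = 2 ∧ m = level x t i) ↔ FollowsEqual x t i) := by
  by_cases hi : (i : ℕ) = 0
  · rw [equalLayer.attentionVector_of_first v rfl i hi]
    refine ⟨0, 0, by simp, by simp, ?_⟩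
    simp [FollowsEqual, hi]
  · obtain ⟨j, hj, he, hmax, hlast⟩ := equalLayer.attentionVector_of_strictFuture v rfl rfl i hi
    rw [he]
    refine ⟨level x t j, x j, h.value j, h.two j, ?_⟩
    have hs : ∀ k : Fin n, equalLayer.score v i k =
        (level x t i : ℚ) ^ 2 - (if IsMarker (x k) then 0 else 1) -
          ((level x t k : ℚ) - level x t i) ^ 2 :=
      fun k => by
        rw [equalLayer, h.queryLayer_score, flags_eq]
        split <;> ring
    refine (rightmost_argmax_iff (top := (level x t i : ℚ) ^ 2)
      (Q := fun k => x k = 2 ∧ level x t k = level x t i)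
      (hit := fun k => IsMarker (x k) ∧ level x t k = level x t i)
      (fun k => ?_) (fun k => ?_) (fun k hk => ⟨Or.inl hk.1, hk.2⟩) hj hmax hlast).trans ?_
    · rw [hs]
      have := sq_nonneg ((level x t k : ℚ) - level x t i)
      split <;> linarith
    · rw [hs]
      have := sq_nonneg ((level x t k : ℚ) - level x t i)
      by_cases hm : IsMarker (x k)
      · rw [if_pos hm]
        simp [hm, sub_eq_zero]
      · rw [if_neg hm]
        simp only [hm, false_and, iff_false]
        intro h'
        linarith
    · simp only [FollowsEqual, not_and, and_assoc, ne_eq]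

/-- The test for `d = 0` under the flag `p`. -/
theorem relu_test_eq (d : ℤ) {p q : Prop} [Decidable p] [Decidable q] (h : p ∧ d = 0 ↔ q) :
    max 0 (-max 0 ((d : ℚ) + 1 - if p then 1 else 0) -
      max 0 (-(d : ℚ) + 1 - if p then 1 else 0) + 1) = if q then 1 else 0 := by
  -- For d ≠ 0 one inner ReLU is at least 1 whatever p is, by integrality; for d = 0 both equal 1 -
  -- p.
  rcases lt_trichotomy d 0 with hd | hd | hd
  · have h' : (d : ℚ) ≤ -1 := by exact_mod_cast Int.le_sub_one_of_lt hd
    have h1 : (1 : ℚ) ≤ -(d : ℚ) + 1 - if p then 1 else 0 := by split <;> linarith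
    rw [if_neg fun hq => hd.ne (h.2 hq).2, max_eq_left]
    have := le_max_right 0 (-(d : ℚ) + 1 - if p then 1 else 0)
    have := le_max_left 0 ((d : ℚ) + 1 - if p then 1 else 0)
    linarith
  · subst hd
    by_cases hp : p <;> simp [hp, ← h]
  · have h' : 1 ≤ (d : ℚ) := by exact_mod_cast hd
    have h1 : (1 : ℚ) ≤ (d : ℚ) + 1 - if p then 1 else 0 := by split <;> linarith
    rw [if_neg fun hq => hd.ne' (h.2 hq).2, max_eq_left]
    have := le_max_left 0 (-(d : ℚ) + 1 - if p then 1 else 0)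
    have := le_max_right 0 ((d : ℚ) + 1 - if p then 1 else 0)
    linarith

theorem HasLevels.congr (h : HasLevels x t v) {v' : Fin n → StateVec}
    (hv : ∀ i, ∀ k : Fin 8, 2 ≤ k → v' i k = v i k) : HasLevels x t v' where
  value i := by rw [hv _ _ (by decide), h.value]
  square i := by rw [hv _ _ (by decide), hv _ _ (by decide), h.square]
  width i := by rw [hv _ _ (by decide), h.width]
  two i := by rw [hv _ _ (by decide), h.two]
  three i := by rw [hv _ _ (by decide), h.three]

open Classical in
/-- The first test. -/
theorem HasLevels.eval_lower (h : HasLevels x t v) (L : LayerSeq 8 1) :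
    ∃ v' : Fin n → StateVec, HasLevels x t v' ∧
      (∀ i, v' i 0 = if FollowsLower x t i then 1 else 0) ∧
      (∀ i, v' i 1 = if level x t i = 0 then 1 else 0) ∧
      LayerSeq.eval (.attention lowerLayer <| .relu 0 <| .relu 1 <|
        .attention lowerTestLayer <| .relu 0 <| .relu 1 L) v = L.eval v' := by
  refine ⟨_, ?_, fun i => ?_, fun i => ?_, rfl⟩
  · refine h.congr fun i k hk => ?_
    have h0 : k ≠ 0 := by rintro rfl; exact absurd hk (by decide)
    have h1 : k ≠ 1 := by rintro rfl; exact absurd hk (by decide)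
    rw [reluLayer_apply_of_ne h1, reluLayer_apply_of_ne h0, lowerTestLayer, affineLayer,
      stateLayer_eval]
    have e : ∀ k : Fin 8, 2 ≤ k → reluLayer 1 (reluLayer 0 (lowerLayer.eval v)) i k = v i k := by
      intro k hk
      have h0 : k ≠ 0 := by rintro rfl; exact absurd hk (by decide)
      have h1 : k ≠ 1 := by rintro rfl; exact absurd hk (by decide)
      rw [reluLayer_apply_of_ne h1, reluLayer_apply_of_ne h0, lowerLayer, queryLayer,
        stateLayer_eval]
      fin_cases k <;> first | exact absurd hk (by decide) | exact add_zero _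
    rw [← e k hk]
    fin_cases k <;> first | exact absurd hk (by decide) | exact add_zero _
  · obtain ⟨m, a, e2, e7, hiff⟩ := h.lowerLayer_attentionVector i
    rw [reluLayer_apply_of_ne (by decide), reluLayer_apply_self, lowerTestLayer, affineLayer,
      stateLayer_eval]
    change max 0 (-(reluLayer 1 (reluLayer 0 (lowerLayer.eval v)) i 0) -
      reluLayer 1 (reluLayer 0 (lowerLayer.eval v)) i 1 + 1) = _
    rw [reluLayer_apply_of_ne (by decide), reluLayer_apply_self, reluLayer_apply_self,
      reluLayer_apply_of_ne (by decide)]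
    have c0 : lowerLayer.eval v i 0 =
        ((level x t i - m - 1 : ℤ) : ℚ) + 1 - if a = 3 then 1 else 0 := by
      rw [← e7, lowerLayer, queryLayer, stateLayer_eval]
      change v i 2 - lowerLayer.attentionVector v i 2 - lowerLayer.attentionVector v i 7 + 0 = _
      rw [e2, h.value, ← queryLayer, ← lowerLayer]
      push_cast
      ring
    have c1 : lowerLayer.eval v i 1 =
        -((level x t i - m - 1 : ℤ) : ℚ) + 1 - if a = 3 then 1 else 0 := by
      rw [← e7, lowerLayer, queryLayer, stateLayer_eval]
      change lowerLayer.attentionVector v i 2 - v i 2 - lowerLayer.attentionVector v i 7 + 2 = _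
      rw [e2, h.value, ← queryLayer, ← lowerLayer]
      push_cast
      ring
    rw [c0, c1]
    exact relu_test_eq _ (Iff.trans (and_congr_right fun _ => by omega) hiff)
  · rw [reluLayer_apply_self, reluLayer_apply_of_ne (by decide), lowerTestLayer, affineLayer,
      stateLayer_eval]
    change max 0 (-(reluLayer 1 (reluLayer 0 (lowerLayer.eval v)) i 2) + 1) = _
    rw [reluLayer_apply_of_ne (by decide), reluLayer_apply_of_ne (by decide), lowerLayer,
      queryLayer, stateLayer_eval]
    change max 0 (-(v i 2 + 0) + 1) = _
    rw [h.value, add_zero]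
    by_cases h0 : level x t i = 0
    · simp [h0]
    · have : (1 : ℚ) ≤ level x t i := by exact_mod_cast Nat.one_le_iff_ne_zero.2 h0
      rw [if_neg h0, max_eq_left (by linarith)]

open Classical in
/-- The second test and the resulting errors. -/
theorem HasLevels.eval_equal (h : HasLevels x t v)
    (h0 : ∀ i, v i 0 = if FollowsLower x t i then 1 else 0)
    (h1 : ∀ i, v i 1 = if level x t i = 0 then 1 else 0) (L : LayerSeq 8 1) :
    ∃ v' : Fin n → StateVec,
      (∀ i, v' i 0 =
        if IsMarker (x i) ∧ level x t i ≠ 0 ∧ ¬ FollowsLower x t i then 1 else 0) ∧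
      (∀ i, v' i 1 = if x i = 3 ∧ ¬ FollowsEqual x t i then 1 else 0) ∧
      (∀ i, v' i 2 = level x t i) ∧ (∀ i, v' i 5 = 2 ^ t) ∧
      (∀ i, v' i 6 + v' i 7 = if IsMarker (x i) then 1 else 0) ∧
      LayerSeq.eval (.attention equalLayer <| .relu 0 <| .relu 1 <| .relu 3 <|
        .attention equalTestLayer <| .relu 1 <| .attention errorLayer <| .relu 1 L) v =
          L.eval v' := by
  set v₁ := reluLayer 3 (reluLayer 1 (reluLayer 0 (equalLayer.eval v))) with hv₁
  set v₂ := reluLayer 1 (equalTestLayer.eval v₁) with hv₂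
  have ev : ∀ i k, equalLayer.eval v i k = _ := fun i k => stateLayer_eval ..
  have ev₁ : ∀ i k, equalTestLayer.eval v₁ i k = _ := fun i k => stateLayer_eval ..
  have ev₂ : ∀ i k, errorLayer.eval v₂ i k = _ := fun i k => stateLayer_eval ..
  have keep₁ : ∀ i, ∀ k ∈ ({2, 5, 6, 7} : Finset (Fin 8)), v₁ i k = v i k := fun i k hk => by
    have : k ≠ 0 ∧ k ≠ 1 ∧ k ≠ 3 := by revert k; decide
    rw [hv₁, reluLayer_apply_of_ne this.2.2, reluLayer_apply_of_ne this.2.1,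
      reluLayer_apply_of_ne this.1, ev]
    fin_cases hk <;> exact add_zero _
  -- From here on coordinate 0 is also preserved, since it holds the first error.
  have keep₂ : ∀ i, ∀ k ∈ ({0, 2, 5, 6, 7} : Finset (Fin 8)), v₂ i k = v₁ i k := fun i k hk => by
    have : k ≠ 1 := by revert k; decide
    rw [hv₂, reluLayer_apply_of_ne this, ev₁]
    fin_cases hk <;> exact add_zero _
  have keep₃ : ∀ i, ∀ k ∈ ({0, 2, 5, 6, 7} : Finset (Fin 8)),
      reluLayer 1 (errorLayer.eval v₂) i k = v₁ i k := fun i k hk => by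
    have : k ≠ 1 := by revert k; decide
    rw [reluLayer_apply_of_ne this, ev₂, ← keep₂ i k hk]
    fin_cases hk <;> exact add_zero _
  refine ⟨reluLayer 1 (errorLayer.eval v₂), fun i => ?_, fun i => ?_, fun i => ?_, fun i => ?_,
    fun i => ?_, rfl⟩
  · rw [keep₃ i 0 (by decide), hv₁, reluLayer_apply_of_ne (by decide),
      reluLayer_apply_of_ne (by decide), reluLayer_apply_self, ev]
    change max 0 (v i 6 + v i 7 - v i 0 - v i 1 + 0) = _
    rw [h0, h1, h.two, h.three, flags_eq]
    by_cases c1 : IsMarker (x i) <;> by_cases c2 : level x t i = 0 <;>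
      by_cases c3 : FollowsLower x t i <;> simp [c1, c2, c3]
  · obtain ⟨m, a, e2, e6, hiff⟩ := h.equalLayer_attentionVector i
    have c1 : equalLayer.eval v i 1 =
        ((level x t i - m : ℤ) : ℚ) + 1 - if a = 2 then 1 else 0 := by
      rw [← e6, ev]
      change v i 2 - equalLayer.attentionVector v i 2 - equalLayer.attentionVector v i 6 + 1 = _
      rw [e2, h.value]
      push_cast
      ring
    have c3 : equalLayer.eval v i 3 =
        -((level x t i - m : ℤ) : ℚ) + 1 - if a = 2 then 1 else 0 := by
      rw [← e6, ev]
      change equalLayer.attentionVector v i 2 - v i 2 - equalLayer.attentionVector v i 6 + 1 = _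
      rw [e2, h.value]
      push_cast
      ring
    have test : v₂ i 1 = if FollowsEqual x t i then 1 else 0 := by
      rw [hv₂, reluLayer_apply_self, ev₁]
      change max 0 (-(v₁ i 1) - v₁ i 3 + 1) = _
      rw [hv₁, reluLayer_apply_of_ne (by decide), reluLayer_apply_self, reluLayer_apply_self,
        reluLayer_apply_of_ne (by decide), reluLayer_apply_of_ne (by decide),
        reluLayer_apply_of_ne (by decide), c1, c3]
      exact relu_test_eq _ (Iff.trans (and_congr_right fun _ => by omega) hiff)
    rw [reluLayer_apply_self, ev₂]
    change max 0 (v₂ i 7 - v₂ i 1 + 0) = _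
    rw [test, keep₂ i 7 (by decide), keep₁ i 7 (by decide), h.three]
    by_cases d1 : x i = 3 <;> by_cases d2 : FollowsEqual x t i <;> simp [d1, d2]
  · rw [keep₃ i 2 (by decide), keep₁ i 2 (by decide), h.value]
  · rw [keep₃ i 5 (by decide), keep₁ i 5 (by decide), h.width]
  · rw [keep₃ i 6 (by decide), keep₁ i 6 (by decide), keep₃ i 7 (by decide),
      keep₁ i 7 (by decide), h.two, h.three, flags_eq]

theorem finalLayer_eval (v : Fin n → StateVec) (i : Fin n) :
    ∃ j, finalLayer.eval v i 0 = v i 2 - v i 5 + (v i 6 + v i 7) - (v j 0 + v j 1) + 1 ∧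
      ∀ k, v k 0 + v k 1 ≤ v j 0 + v j 1 := by
  obtain ⟨j, he, hmax⟩ := finalLayer.attentionVector_of_none v rfl i
  refine ⟨j, ?_, fun k => ?_⟩
  · rw [finalLayer, stateLayer_eval, ← finalLayer, he]
    change v i 2 - v i 5 + v i 6 + v i 7 - v j 0 - v j 1 + 1 = _
    ring
  · simpa [finalLayer, stateLayer_score] using hmax k

/-- The tests succeed at the last position exactly on layered words. -/
theorem HasLevels.eval_testLayers_pos_iff (h : HasLevels x t v) (hn : 0 < n) :
    0 < testLayers.eval v ⟨n - 1, Nat.sub_lt hn Nat.one_pos⟩ 0 ↔ IsLayered x t n := by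
  classical
  obtain ⟨v₁, h1, h10, h11, e1⟩ := h.eval_lower (.attention equalLayer <| .relu 0 <| .relu 1 <|
    .relu 3 <| .attention equalTestLayer <| .relu 1 <| .attention errorLayer <| .relu 1 <|
    .attention finalLayer <| .nil 1)
  obtain ⟨v₂, h20, h21, h22, h25, h267, e2⟩ :=
    h1.eval_equal h10 h11 (.attention finalLayer <| .nil 1)
  rw [testLayers, e1, e2]
  change 0 < finalLayer.eval v₂ ⟨n - 1, Nat.sub_lt hn Nat.one_pos⟩ 0 ↔ _
  obtain ⟨j, ej, hmax⟩ := finalLayer_eval v₂ ⟨n - 1, Nat.sub_lt hn Nat.one_pos⟩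
  rw [ej, h22, h25, h267]
  have hlt : level x t (n - 1) + 1 ≤ 2 ^ t := level_lt x t (n - 1)
  have hltq : (level x t (n - 1) : ℚ) + 1 ≤ 2 ^ t := by exact_mod_cast hlt
  constructor
  · intro hpos
    have hj0 : 0 ≤ v₂ j 0 := by rw [h20]; split <;> norm_num
    have hj1 : 0 ≤ v₂ j 1 := by rw [h21]; split <;> norm_num
    have hmark : IsMarker (x (n - 1)) := by
      by_contra hm
      rw [if_neg hm] at hpos
      linarith
    rw [if_pos hmark] at hpos
    have hlev : level x t (n - 1) + 1 = 2 ^ t := by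
      by_contra hne
      have : level x t (n - 1) + 1 + 1 ≤ 2 ^ t := by omega
      have : (level x t (n - 1) : ℚ) + 1 + 1 ≤ 2 ^ t := by exact_mod_cast this
      linarith
    -- Position j maximizes the error sum, so this bound excludes an error of value 1 at every
    -- position.
    have hsum : v₂ j 0 + v₂ j 1 < 1 := by
      have : (level x t (n - 1) : ℚ) + 1 = 2 ^ t := by exact_mod_cast hlev
      linarith
    refine ⟨fun i hi hm hl => ?_, fun i hi h3 => ?_, hn, hmark, hlev⟩
    · by_contra hf
      have a0 := h20 ⟨i, hi⟩
      rw [if_pos ⟨hm, hl, hf⟩] at a0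
      have a1 : 0 ≤ v₂ ⟨i, hi⟩ 1 := by rw [h21]; split <;> norm_num
      have := hmax ⟨i, hi⟩
      linarith
    · by_contra hf
      have a1 := h21 ⟨i, hi⟩
      rw [if_pos ⟨h3, hf⟩] at a1
      have a0 : 0 ≤ v₂ ⟨i, hi⟩ 0 := by rw [h20]; split <;> norm_num
      have := hmax ⟨i, hi⟩
      linarith
  · intro hL
    have a0 : v₂ j 0 = 0 := by
      rw [h20, if_neg]
      rintro ⟨hm, hl, hf⟩
      exact hf (hL.followsLower j j.2 hm hl)
    have a1 : v₂ j 1 = 0 := by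
      rw [h21, if_neg]
      rintro ⟨hm, hf⟩
      exact hf (hL.followsEqual j j.2 hm)
    have : (level x t (n - 1) : ℚ) + 1 = 2 ^ t := by exact_mod_cast hL.level_last
    rw [if_pos hL.isMarker_last, a0, a1]
    linarith

end Tests

/-- Any extension x of the word to all of ℕ is allowed, so this applies both to `rulerWord` and to
padding by `0`. -/
theorem mem_layeredUHAT_lang_iff {t : ℕ} {w : List (Fin 4)} {x : ℕ → Fin 4}
    (hx : ∀ i : Fin w.length, w.get i = x i) :
    w ∈ (layeredUHAT t).lang ↔ IsLayered x t w.length := by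
  have hstate : IsState x 0 fun i : Fin w.length => (layeredUHAT t).emb (w.get i) := by
    refine ⟨⟨fun i => ?_, fun i => ?_, fun i => ?_, fun i => ?_, fun i => ?_⟩, fun i => ?_,
      fun i => ?_⟩ <;> simp [layeredUHAT, level, ← hx]
  obtain ⟨v, hv, he⟩ := hstate.eval_levelLayers testLayers t
  rw [zero_add] at hv
  have hrun : ∀ h : 0 < w.length, dotProduct (layeredUHAT t).acceptVec
      ((layeredUHAT t).run w ((layeredUHAT t).output.index w.length h)) =
        testLayers.eval v ⟨w.length - 1, Nat.sub_lt h Nat.one_pos⟩ 0 := fun h => by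
    rw [← he]
    change dotProduct (1 : Fin 1 → ℚ) _ = _
    have hone : ∀ u : Fin 1 → ℚ, dotProduct 1 u = u 0 := fun u => by
      simp [dotProduct]
    exact hone _
  constructor
  · rintro ⟨h, hp⟩
    rw [hrun h] at hp
    exact (hv.toHasLevels.eval_testLayers_pos_iff h).1 hp
  · intro hL
    refine ⟨hL.pos, ?_⟩
    rw [hrun hL.pos]
    exact (hv.toHasLevels.eval_testLayers_pos_iff hL.pos).2 hL

theorem layeredUHAT_lang_nonempty (t : ℕ) : ∃ w, w ∈ (layeredUHAT t).lang := by
  refine ⟨List.ofFn fun i : Fin ((t + 1) * 3 ^ (2 ^ t - 1)) => rulerWord t i, ?_⟩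
  rw [mem_layeredUHAT_lang_iff (x := rulerWord t) (fun i => by simp), List.length_ofFn]
  exact isLayered_rulerWord t

theorem two_pow_le_length_of_mem_layeredUHAT_lang {t : ℕ} {w : List (Fin 4)}
    (hw : w ∈ (layeredUHAT t).lang) : 2 ^ (2 ^ t - 1) ≤ w.length :=
  ((mem_layeredUHAT_lang_iff (x := fun i => w.getD i 0) fun i => by simp).1 hw).two_pow_le

theorem mainTheorem4 :
    CanBeDoublyExpMoreSuccinct uhatClass finiteAutomatonClass ∧
    (∃ (k : ℕ → ℕ) (T : (n : ℕ) → UHAT (k n)) (p : Polynomial ℕ),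
      (∀ n, (T n).size ≤ p.eval n ∧
        (∃ w, w ∈ (T n).lang) ∧
        ∀ w ∈ (T n).lang, 2 ^ 2 ^ n ≤ w.length) ∧
      ∀ f : ℕ → ℝ, IsDoublyExpLittleO f →
        ∃ n, ForcesBlowup (C₁ := uhatClass) finiteAutomatonClass f (T n)) ∧
    (∀ (k : ℕ) (A : FiniteAutomaton k), (∃ w, w ∈ A.lang) →
      ∃ w ∈ A.lang, w.length ≤ A.numStates) := by
  -- The shift to n + 1 absorbs the -1 in the length bound: 2 ^ (n + 1) - 1 ≥ 2 ^ n.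
  obtain ⟨a, b, hb, hsize⟩ : ∃ a b : ℕ, 0 < b ∧
      ∀ n, (layeredUHAT (n + 1)).size = a + b * n := by
    have h := size_layeredUHAT
    generalize prevLayer.code.length + (natCode (3 : Fin 8)).length = K at h
    refine ⟨(layeredUHAT 0).size + (K + 4), K + 4, Nat.succ_pos _, fun n => ?_⟩
    rw [h]
    ring
  have hne : ∀ n, ∃ w, w ∈ (layeredUHAT (n + 1)).lang := fun n => layeredUHAT_lang_nonempty _
  have hlen : ∀ n, ∀ w ∈ (layeredUHAT (n + 1)).lang, 2 ^ 2 ^ n ≤ w.length := fun n w hw => by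
    refine le_trans (Nat.pow_le_pow_right (by norm_num) ?_)
      (two_pow_le_length_of_mem_layeredUHAT_lang hw)
    have := Nat.one_le_two_pow (n := n)
    rw [pow_succ]
    omega
  have hblow : ∀ f : ℕ → ℝ, IsDoublyExpLittleO f → ∃ n,
      ForcesBlowup (C₁ := uhatClass) finiteAutomatonClass f (layeredUHAT (n + 1)) := fun f hf =>
    exists_forcesBlowup_of_linear_size (fun n => layeredUHAT (n + 1)) hb hsize hne hlen hf
  refine ⟨fun f hf => ?_, ⟨fun _ => 4, fun n => layeredUHAT (n + 1),
    Polynomial.C a + Polynomial.C b * Polynomial.X, fun n => ⟨?_, hne n, hlen n⟩, hblow⟩,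
    fun k A h => A.exists_mem_lang_length_le h⟩
  · obtain ⟨n, hn⟩ := hblow f hf
    exact ⟨4, _, hn⟩
  · simp [hsize]
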